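/- All graphs are finite, simple, undirected and have at least one vertex. For a graph $G$ with vertices $v_1,\dots,v_n$ of degrees $d_1,\dots,d_n$, let $A(G)$ be the adjacency matrix, $D(G)=\mathrm{diag}(d_1,\dots,d_n)$, $L(G)=D(G)-A(G)$ the Laplacian, $Q(G)=D(G)+A(G)$ the signless Laplacian, and $\mathcal{L}(G)$ the normalized Laplacian, whose $(i,j)$ entry is $1$ if $i=j$ and $d_i\neq 0$, is $-1/\sqrt{d_id_j}$ if $v_i$ and $v_j$ are adjacent, and is $0$ otherwise. For $X\in\{A,L,Q,\mathcal{L}\}$, the $X$-spectrum of $G$ is the multiset of roots, with multiplicities, of the characteristic polynomial of $X(G)$, and two graphs are $X$-cospectral if they have the same $X$-spectrum. Two regular graphs are called cospectral if they are $X$-cospectral for some $X\in\{A,L,Q,\mathcal{L}\}$ (for regular graphs, this is equivalent to $X$-cospectrality for every such $X$). For vertex-disjoint graphs $G_1$ and $G_2$ with $V(G_1)=\{u_1,\dots,u_n\}$, the NNS join $G_1\underset{=}{\vee}G_2$ is the graph obtained from the join $G_1\vee G_2$ (the disjoint union of $G_1$ and $G_2$ together with all edges between $V(G_1)$ and $V(G_2)$)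 by adding new vertices $u_1',\dots,u_n'$ and connecting $u_i'$ to $u_j$ if and only if $i\neq j$ and $u_i$ and $u_j$ are not adjacent in $G_1$; the new vertices have no other neighbors. Let $G_1,H_1$ be regular cospectral graphs, and let $G_2,H_2$ be regular cospectral graphs that are not isomorphic. Then $G_1\underset{=}{\vee}G_2$ and $H_1\underset{=}{\vee}H_2$ are both non-regular, are not isomorphic to each other, and are $X$-cospectral for every $X\in\{A,L,Q,\mathcal{L}\}$. -/

import Mathlib

namespace SimpleGraph

variable {V V₁ V₂ W : Type*}

section Matrices

variable [Fintype V] [DecidableEq V] (G : SimpleGraph V) [DecidableRel G.Adj]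

/-- The signless Laplacian matrix `D(G) + A(G)`. -/
def signlessLapMatrix : Matrix V V ℝ :=
  G.degMatrix ℝ + G.adjMatrix ℝ

/-- The normalized Laplacian matrix: the diagonal entry of a vertex is `1` if its degree is
nonzero and `0` otherwise, the entry of a pair of adjacent vertices is `-1 / √(dᵢ dⱼ)`, and all
other entries are `0`. -/
noncomputable def normalizedLapMatrix : Matrix V V ℝ :=
  Matrix.of fun i j =>
    if i = j then (if G.degree i = 0 then 0 else 1)
    else if G.Adj i j then -(1 / Real.sqrt ((G.degree i : ℝ) * (G.degree j : ℝ)))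
    else 0

end Matrices

/-- The four kinds of matrices associated with a graph: adjacency (`A`), Laplacian (`L`),
signless Laplacian (`Q`) and normalized Laplacian (`N`). -/
inductive MatrixKind
  | A
  | L
  | Q
  | N

section Spectrum

variable [Fintype V] [DecidableEq V]

/-- The matrix `X(G)` for `X` one of the four kinds. -/
noncomputable def matrixOf (X : MatrixKind) (G : SimpleGraph V) [DecidableRel G.Adj] :
    Matrix V V ℝ :=
  match X with
  | .A => G.adjMatrix ℝ
  | .L => G.lapMatrix ℝ
  | .Q => G.signlessLapMatrix
  | .N => G.normalizedLapMatrix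

/-- The `X`-spectrum of `G`: the multiset of roots of the characteristic polynomial of `X(G)`,
with multiplicities. All roots are real since `X(G)` is a real symmetric matrix. -/
noncomputable def matrixSpectrum (X : MatrixKind) (G : SimpleGraph V) [DecidableRel G.Adj] :
    Multiset ℝ :=
  (matrixOf X G).charpoly.roots

variable [Fintype W] [DecidableEq W]

/-- `G` and `H` are `X`-cospectral if they have the same `X`-spectrum. -/
def XCospectral (X : MatrixKind) (G : SimpleGraph V) (H : SimpleGraph W)
    [DecidableRel G.Adj] [DecidableRel H.Adj] : Prop :=
  matrixSpectrum X G = matrixSpectrum X H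

/-- Cospectrality, as used for regular graphs: `X`-cospectrality for any one of the four
matrices `X`. (For regular graphs, the choice of `X` does not matter.) -/
def CospectralReg (G : SimpleGraph V) (H : SimpleGraph W)
    [DecidableRel G.Adj] [DecidableRel H.Adj] : Prop :=
  ∃ X : MatrixKind, XCospectral X G H

/-- `G` and `H` are non-isomorphic and `X`-cospectral for each of the four matrices `X`. -/
def ALQNNICS (G : SimpleGraph V) (H : SimpleGraph W)
    [DecidableRel G.Adj] [DecidableRel H.Adj] : Prop :=
  ∀ X : MatrixKind, XCospectral X G H ∧ IsEmpty (G ≃g H)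

/-- `G` is regular, that is, all its vertices have the same degree. -/
def IsRegularGraph (G : SimpleGraph V) [DecidableRel G.Adj] : Prop :=
  ∃ d : ℕ, G.IsRegularOfDegree d

end Spectrum

/-- The NNS (non-neighbors splitting) join of `G₁` and `G₂`. The vertices are
`inl u` (the vertices of `G₁`), `inr (inl u)` (the added copy `u'` of the vertex `u` of `G₁`) and
`inr (inr v)` (the vertices of `G₂`). The first and the third part carry the join of `G₁` and
`G₂`, and `u'` is adjacent to a vertex `w` of `G₁` iff `u` and `w` are distinct and non-adjacent
in `G₁`. -/
def nnsJoin (G₁ : SimpleGraph V₁) (G₂ : SimpleGraph V₂) : SimpleGraph (V₁ ⊕ (V₁ ⊕ V₂)) where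
  Adj
    | .inl u, .inl w => G₁.Adj u w
    | .inl u, .inr (.inl w) => u ≠ w ∧ ¬ G₁.Adj u w
    | .inl _, .inr (.inr _) => True
    | .inr (.inl u), .inl w => u ≠ w ∧ ¬ G₁.Adj u w
    | .inr (.inl _), .inr _ => False
    | .inr (.inr _), .inl _ => True
    | .inr (.inr _), .inr (.inl _) => False
    | .inr (.inr v), .inr (.inr w) => G₂.Adj v w
  symm := ⟨by
    rintro (u | u | u) (w | w | w) h
    all_goals first
      | exact h
      | exact SimpleGraph.Adj.symm h
      | exact ⟨Ne.symm h.1, fun h' => h.2 (SimpleGraph.Adj.symm h')⟩⟩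
  loopless := ⟨by
    rintro (u | u | u) h
    · exact G₁.loopless.irrefl u h
    · exact h
    · exact G₂.loopless.irrefl u h⟩

instance nnsJoinDecidable [DecidableEq V₁] (G₁ : SimpleGraph V₁) (G₂ : SimpleGraph V₂)
    [DecidableRel G₁.Adj] [DecidableRel G₂.Adj] : DecidableRel (nnsJoin G₁ G₂).Adj
  | .inl u, .inl w => inferInstanceAs (Decidable (G₁.Adj u w))
  | .inl u, .inr (.inl w) => inferInstanceAs (Decidable (u ≠ w ∧ ¬ G₁.Adj u w))
  | .inl _, .inr (.inr _) => inferInstanceAs (Decidable True)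
  | .inr (.inl u), .inl w => inferInstanceAs (Decidable (u ≠ w ∧ ¬ G₁.Adj u w))
  | .inr (.inl _), .inr (.inl _) => inferInstanceAs (Decidable False)
  | .inr (.inl _), .inr (.inr _) => inferInstanceAs (Decidable False)
  | .inr (.inr _), .inl _ => inferInstanceAs (Decidable True)
  | .inr (.inr _), .inr (.inl _) => inferInstanceAs (Decidable False)
  | .inr (.inr v), .inr (.inr w) => inferInstanceAs (Decidable (G₂.Adj v w))

end SimpleGraph

/-! Equality of spectra for real symmetric matrices is the same as the existence of an orthogonal
`P` with `A * P = P * B`. For regular graphs such a `P` for any one of the four matrices forces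
equal degrees and intertwines the adjacency matrices. The all-ones vector is then an eigenvector of
both for the same eigenvalue, so a reflection corrects `P` to fix it
(`IsOrthogonal.exists_mulVec_one`).

Now `diag(P₁, P₁, P₂)` intertwines the adjacency matrices of the two joins, since their blocks are
`0`, all-ones matrices `J`, `A(G₁)`, `A(G₂)` and `J - 1 - A(G₁)`. It also intertwines every function
of the degrees, which are constant on each of the three parts. All four matrices are assembled from
these (`xCospectral_of_intertwines`).

Degrees also show that the joins are not regular and, unless `G₂` is complete, that an isomorphism
of joins restricts to the second factors. -/

set_option linter.unusedSectionVars false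

/-! ### Orthogonal intertwiners of symmetric matrices -/

namespace Matrix

variable {V W : Type*} [Fintype V] [DecidableEq V] [Fintype W] [DecidableEq W]

/-- A real matrix, with possibly different index types for rows and columns, whose inverse is its
transpose. -/
structure IsOrthogonal (P : Matrix V W ℝ) : Prop where
  mul_transpose_self : P * Pᵀ = 1
  transpose_mul_self : Pᵀ * P = 1

theorem charpoly_eq_of_roots_eq {A : Matrix V V ℝ} {B : Matrix W W ℝ} (hA : A.IsHermitian)
    (hB : B.IsHermitian) (h : A.charpoly.roots = B.charpoly.roots) :
    A.charpoly = B.charpoly := by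
  rw [hA.splits_charpoly.eq_prod_roots_of_monic (charpoly_monic A),
    hB.splits_charpoly.eq_prod_roots_of_monic (charpoly_monic B), h]

/-- Both matrices diagonalise to the same `D`, as `U * D * Uᵀ` and `T * D * Tᵀ`, so `U * Tᵀ`
intertwines them. The spectral theorem is compared on a common index type, hence the reindexing of
`B`. -/
theorem exists_isOrthogonal_of_roots_eq {A : Matrix V V ℝ} {B : Matrix W W ℝ}
    (hA : A.IsHermitian) (hB : B.IsHermitian) (h : A.charpoly.roots = B.charpoly.roots) :
    Fintype.card V = Fintype.card W ∧ ∃ P : Matrix V W ℝ, P.IsOrthogonal ∧ A * P = P * B := by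
  have hc := charpoly_eq_of_roots_eq hA hB h
  have hcard : Fintype.card V = Fintype.card W := by
    rw [← charpoly_natDegree_eq_dim A, ← charpoly_natDegree_eq_dim B, hc]
  refine ⟨hcard, ?_⟩
  let e : V ≃ W := Fintype.equivOfCardEq hcard
  have hB' : (B.submatrix e e).IsHermitian := hB.submatrix e
  have hBc : (B.submatrix e e).charpoly = B.charpoly := charpoly_reindex e.symm B
  have hev : hA.eigenvalues = hB'.eigenvalues :=
    (hA.eigenvalues_eq_eigenvalues_iff hB').2 (hc.trans hBc.symm)
  have sA := hA.spectral_theorem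
  have sB := hB'.spectral_theorem
  rw [Unitary.conjStarAlgAut_apply] at sA sB
  rw [← hev] at sB
  set D : Matrix V V ℝ := diagonal (RCLike.ofReal ∘ hA.eigenvalues)
  set U : Matrix V V ℝ := hA.eigenvectorUnitary.1
  set T : Matrix V V ℝ := hB'.eigenvectorUnitary.1
  have hU1 : U * Uᵀ = 1 := Unitary.coe_mul_star_self hA.eigenvectorUnitary
  have hU2 : Uᵀ * U = 1 := Unitary.coe_star_mul_self hA.eigenvectorUnitary
  have hT1 : T * Tᵀ = 1 := Unitary.coe_mul_star_self hB'.eigenvectorUnitary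
  have hT2 : Tᵀ * T = 1 := Unitary.coe_star_mul_self hB'.eigenvectorUnitary
  have sA' : A = U * D * Uᵀ := sA
  have sB' : B.submatrix e e = T * D * Tᵀ := sB
  have key : A * (U * Tᵀ) = (U * Tᵀ) * B.submatrix e e := by
    rw [sA', sB']
    calc U * D * Uᵀ * (U * Tᵀ) = U * D * (Uᵀ * U) * Tᵀ := by simp only [Matrix.mul_assoc]
      _ = U * (Tᵀ * T) * D * Tᵀ := by rw [hU2, hT2]; simp
      _ = _ := by simp only [Matrix.mul_assoc]
  refine ⟨(U * Tᵀ).submatrix id e.symm, ⟨?_, ?_⟩, ?_⟩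
  · rw [transpose_submatrix, submatrix_mul_equiv, transpose_mul, transpose_transpose,
      submatrix_id_id]
    calc U * Tᵀ * (T * Uᵀ) = U * (Tᵀ * T) * Uᵀ := by simp only [Matrix.mul_assoc]
      _ = 1 := by rw [hT2, Matrix.mul_one, hU1]
  · rw [transpose_submatrix, ← submatrix_mul _ _ _ _ _ Function.bijective_id, transpose_mul,
      transpose_transpose]
    have : T * Uᵀ * (U * Tᵀ) = 1 := by
      calc T * Uᵀ * (U * Tᵀ) = T * (Uᵀ * U) * Tᵀ := by simp only [Matrix.mul_assoc]
        _ = 1 := by rw [hU2, Matrix.mul_one, hT1]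
    rw [this, submatrix_one_equiv]
  · calc A * (U * Tᵀ).submatrix id e.symm = (A * (U * Tᵀ)).submatrix id e.symm := by
          ext i j; simp [mul_apply]
      _ = (U * Tᵀ * B.submatrix e e).submatrix id e.symm := by rw [key]
      _ = (U * Tᵀ).submatrix id e.symm * (B.submatrix e e).submatrix e.symm e.symm := by
          rw [submatrix_mul_equiv]
      _ = _ := by simp

/-- `A` is the product of `P` and `B * Pᵀ`, and the reversed product is `B`; swapping rectangular
factors changes the characteristic polynomial only by powers of `X`, which agree here. -/
theorem IsOrthogonal.charpoly_eq {P : Matrix V W ℝ} (hP : P.IsOrthogonal)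
    (hcard : Fintype.card V = Fintype.card W) {A : Matrix V V ℝ} {B : Matrix W W ℝ}
    (h : A * P = P * B) : A.charpoly = B.charpoly := by
  have h1 : A = P * (B * Pᵀ) := by
    rw [← Matrix.mul_assoc, ← h, Matrix.mul_assoc, hP.mul_transpose_self, Matrix.mul_one]
  have h2 := charpoly_mul_comm' P (B * Pᵀ)
  rw [← h1, Matrix.mul_assoc, hP.transpose_mul_self, Matrix.mul_one, hcard] at h2
  exact mul_left_cancel₀ (pow_ne_zero _ Polynomial.X_ne_zero) h2

theorem IsOrthogonal.trace_eq {P : Matrix V W ℝ} (hP : P.IsOrthogonal) {A : Matrix V V ℝ}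
    {B : Matrix W W ℝ} (h : A * P = P * B) : A.trace = B.trace := by
  rw [← Matrix.mul_one A, ← hP.mul_transpose_self, ← Matrix.mul_assoc, h, Matrix.mul_assoc,
    trace_mul_comm, Matrix.mul_assoc, hP.transpose_mul_self, Matrix.mul_one]

/-- The matrix of the reflection in the hyperplane orthogonal to `w`. -/
noncomputable def reflection (w : V → ℝ) : Matrix V V ℝ :=
  1 - (2 / (w ⬝ᵥ w)) • vecMulVec w w

theorem transpose_reflection (w : V → ℝ) : (reflection w)ᵀ = reflection w := by
  simp [reflection, transpose_vecMulVec]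

theorem reflection_mulVec (w v : V → ℝ) :
    reflection w *ᵥ v = v - (2 / (w ⬝ᵥ w) * (w ⬝ᵥ v)) • w := by
  ext i
  simp [reflection, sub_mulVec, smul_mulVec, vecMulVec_mulVec]
  ring

theorem reflection_mul_self (w : V → ℝ) : reflection w * reflection w = 1 := by
  -- Here `2 / 0 = 0`, so the reflection degenerates to the identity.
  by_cases hw : w ⬝ᵥ w = 0
  · simp [reflection, hw]
  · simp only [reflection, Matrix.mul_sub, Matrix.sub_mul, Matrix.mul_one, Matrix.one_mul,
      Matrix.mul_smul, Matrix.smul_mul, vecMulVec_mul_vecMulVec, smul_smul, vecMulVec_smul]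
    rw [div_mul_cancel₀ _ hw]
    module

theorem mul_reflection_comm {A : Matrix V V ℝ} (hA : Aᵀ = A) {w : V → ℝ} {r : ℝ}
    (hw : A *ᵥ w = r • w) : A * reflection w = reflection w * A := by
  have : w ᵥ* A = r • w := by rw [← hA, vecMul_transpose, hw]
  simp only [reflection, Matrix.mul_sub, Matrix.sub_mul, Matrix.mul_one, Matrix.one_mul,
      Matrix.mul_smul, Matrix.smul_mul, mul_vecMulVec, vecMulVec_mul, this, hw, smul_vecMulVec,
      vecMulVec_smul]

/-- Two symmetric matrices that are orthogonally conjugate and have the all-ones vector as an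
eigenvector for the same eigenvalue are conjugate by an orthogonal matrix that preserves the
all-ones vector. -/
theorem IsOrthogonal.exists_mulVec_one {P : Matrix V W ℝ} (hP : P.IsOrthogonal)
    (hcard : Fintype.card V = Fintype.card W) {A : Matrix V V ℝ} {B : Matrix W W ℝ}
    (hA : Aᵀ = A) (h : A * P = P * B) {r : ℝ} (hAr : A *ᵥ 1 = r • 1) (hBr : B *ᵥ 1 = r • 1) :
    ∃ R : Matrix V W ℝ, R.IsOrthogonal ∧ A * R = R * B ∧ R *ᵥ 1 = 1 := by
  set u : V → ℝ := P *ᵥ 1 with hu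
  have hAu : A *ᵥ u = r • u := by
    rw [hu, mulVec_mulVec, h, ← mulVec_mulVec, hBr, mulVec_smul]
  have huu : u ⬝ᵥ u = (1 : V → ℝ) ⬝ᵥ 1 := by
    rw [hu, dotProduct_mulVec, vecMul_mulVec, ← dotProduct_mulVec, hP.transpose_mul_self, one_mulVec]
    simp [hcard]
  set w := u - 1 with hwdef
  have hw : A *ᵥ w = r • w := by rw [hwdef, mulVec_sub, hAu, hAr, smul_sub]
  -- As `u` and `1` have equal length, this makes the reflection in `w` send `u` to `u - w = 1`.
  have hww : w ⬝ᵥ w = 2 * (w ⬝ᵥ u) := by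
    have := dotProduct_comm u 1
    simp only [hwdef, sub_dotProduct, dotProduct_sub]
    linarith
  have hS := reflection_mul_self w
  have hSt := transpose_reflection w
  refine ⟨reflection w * P, ⟨?_, ?_⟩, ?_, ?_⟩
  · rw [transpose_mul, hSt, Matrix.mul_assoc, ← Matrix.mul_assoc P, hP.mul_transpose_self,
      Matrix.one_mul, hS]
  · rw [transpose_mul, hSt, Matrix.mul_assoc, ← Matrix.mul_assoc (reflection w), hS,
      Matrix.one_mul, hP.transpose_mul_self]
  · rw [← Matrix.mul_assoc, mul_reflection_comm hA hw, Matrix.mul_assoc, h, Matrix.mul_assoc]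
  · rw [← mulVec_mulVec, ← hu, reflection_mulVec]
    by_cases h0 : w ⬝ᵥ w = 0
    · have : w = 0 := dotProduct_self_eq_zero.1 h0
      rw [this, smul_zero, sub_zero, ← sub_eq_zero, ← hwdef, this]
    · rw [div_mul_eq_mul_div, ← hww, div_self h0, one_smul, hwdef, sub_sub_cancel]

theorem IsOrthogonal.transpose_mulVec_one {P : Matrix V W ℝ} (hP : P.IsOrthogonal)
    (h : P *ᵥ 1 = 1) : Pᵀ *ᵥ 1 = 1 := by
  have := congrArg (Pᵀ *ᵥ ·) h
  rwa [mulVec_mulVec, hP.transpose_mul_self, one_mulVec, eq_comm] at this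

end Matrix

namespace SimpleGraph

open Matrix

/-! ### The four matrices of a regular graph -/

section Regular

variable {V W : Type*} [Fintype V] [DecidableEq V] [Fintype W] [DecidableEq W]

/-- Isolated vertices need no separate case in the scaling factors, because `0⁻¹ = 0`. -/
theorem normalizedLapMatrix_eq (G : SimpleGraph V) [DecidableRel G.Adj] :
    G.normalizedLapMatrix = diagonal (fun i => if G.degree i = 0 then (0 : ℝ) else 1) -
      diagonal (fun i => (√(G.degree i : ℝ))⁻¹) * G.adjMatrix ℝ *
        diagonal (fun i => (√(G.degree i : ℝ))⁻¹) := by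
  ext i j
  simp only [normalizedLapMatrix, of_apply, Matrix.sub_apply, Matrix.mul_diagonal,
    Matrix.diagonal_mul, adjMatrix_apply]
  by_cases hij : i = j
  · subst hij; simp
  · by_cases h : G.Adj i j
    · simp [hij, h, Real.sqrt_mul, mul_comm]
    · simp [hij, h]

theorem isHermitian_matrixOf (X : MatrixKind) (G : SimpleGraph V) [DecidableRel G.Adj] :
    (matrixOf X G).IsHermitian := by
  cases X
  · exact G.isHermitian_adjMatrix ℝ
  · exact G.isHermitian_lapMatrix ℝ
  · exact (G.isHermitian_degMatrix ℝ).add (G.isHermitian_adjMatrix ℝ)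
  · refine IsHermitian.ext fun i j => ?_
    simp only [matrixOf, normalizedLapMatrix, of_apply, star_trivial, eq_comm (a := j),
      G.adj_comm j, mul_comm (G.degree j : ℝ)]
    by_cases h : i = j
    · subst h; simp
    · simp [h]

variable {G : SimpleGraph V} [DecidableRel G.Adj] {H : SimpleGraph W} [DecidableRel H.Adj]
  {r s : ℕ}

theorem IsRegularOfDegree.degMatrix_eq (h : G.IsRegularOfDegree r) :
    G.degMatrix ℝ = (r : ℝ) • 1 := by
  simp [degMatrix, h.degree_eq, smul_one_eq_diagonal]

theorem IsRegularOfDegree.normalizedLapMatrix_eq (h : G.IsRegularOfDegree r) :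
    G.normalizedLapMatrix = (if r = 0 then (0 : ℝ) else 1) • 1 - (r : ℝ)⁻¹ • G.adjMatrix ℝ := by
  rw [SimpleGraph.normalizedLapMatrix_eq]
  simp only [h.degree_eq, ← smul_one_eq_diagonal, Matrix.smul_mul,
    Matrix.mul_smul, Matrix.mul_one, Matrix.one_mul, smul_smul, ← mul_inv, Real.mul_self_sqrt (Nat.cast_nonneg r)]

theorem IsRegularOfDegree.trace_adjMatrix_mul_self (h : G.IsRegularOfDegree r) :
    (G.adjMatrix ℝ * G.adjMatrix ℝ).trace = Fintype.card V * r := by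
  simp only [trace, diag_apply, adjMatrix_mul_self_apply_self, h.degree_eq, Finset.sum_const,
    Finset.card_univ, nsmul_eq_mul]

theorem IsRegularOfDegree.adjMatrix_mulVec_one (h : G.IsRegularOfDegree r) :
    G.adjMatrix ℝ *ᵥ 1 = (r : ℝ) • 1 := by
  ext i
  simp [adjMatrix_mulVec_apply, h.degree_eq]

theorem IsRegularOfDegree.adjMatrix_eq_zero (h : G.IsRegularOfDegree 0) : G.adjMatrix ℝ = 0 := by
  ext i j
  have : ¬ G.Adj i j := fun hij => by
    have := (G.degree_pos_iff_exists_adj i).2 ⟨j, hij⟩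
    rw [h.degree_eq] at this
    exact this.false
  simp [this]

/-- An orthogonal matrix conjugating one of the four matrices of two regular graphs shows that the
degrees agree and conjugates the adjacency matrices. -/
theorem IsRegularOfDegree.eq_and_adjMatrix_mul_eq [Nonempty V] (hG : G.IsRegularOfDegree r)
    (hH : H.IsRegularOfDegree s) (hcard : Fintype.card V = Fintype.card W) {P : Matrix V W ℝ}
    (hP : P.IsOrthogonal) {X : MatrixKind} (h : matrixOf X G * P = P * matrixOf X H) :
    r = s ∧ G.adjMatrix ℝ * P = P * H.adjMatrix ℝ := by
  have hn : (Fintype.card W : ℝ) ≠ 0 := by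
    rw [← hcard]; exact_mod_cast Fintype.card_ne_zero
  have hn' : (Fintype.card V : ℝ) = Fintype.card W := by rw [hcard]
  have htr := hP.trace_eq h
  cases X with
  | A =>
    refine ⟨?_, h⟩
    -- The trace of `A` vanishes, so the degree is read off from the trace of `A²`.
    have h2 : matrixOf .A G * matrixOf .A G * P = P * (matrixOf .A H * matrixOf .A H) := by
      rw [Matrix.mul_assoc, h, ← Matrix.mul_assoc, h, Matrix.mul_assoc]
    have := hP.trace_eq h2
    simp only [matrixOf, hG.trace_adjMatrix_mul_self, hH.trace_adjMatrix_mul_self, hn'] at this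
    exact_mod_cast mul_left_cancel₀ hn this
  | L =>
    simp only [matrixOf, lapMatrix, hG.degMatrix_eq, hH.degMatrix_eq, trace_sub, trace_smul,
      trace_one, trace_adjMatrix, hn', sub_zero, smul_eq_mul] at htr
    have hrs : r = s := by exact_mod_cast mul_right_cancel₀ hn htr
    subst hrs
    refine ⟨rfl, ?_⟩
    simpa [matrixOf, lapMatrix, hG.degMatrix_eq, hH.degMatrix_eq, Matrix.sub_mul,
      Matrix.mul_sub] using h
  | Q =>
    simp only [matrixOf, signlessLapMatrix, hG.degMatrix_eq, hH.degMatrix_eq, trace_add, trace_smul,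
      trace_one, trace_adjMatrix, hn', add_zero, smul_eq_mul] at htr
    have hrs : r = s := by exact_mod_cast mul_right_cancel₀ hn htr
    subst hrs
    refine ⟨rfl, ?_⟩
    simpa [matrixOf, signlessLapMatrix, hG.degMatrix_eq, hH.degMatrix_eq, Matrix.add_mul,
      Matrix.mul_add] using h
  | N =>
    simp only [matrixOf, hG.normalizedLapMatrix_eq, hH.normalizedLapMatrix_eq] at h htr
    simp only [trace_sub, trace_smul, trace_one, trace_adjMatrix, hn', smul_eq_mul, mul_zero,
      sub_zero] at htr
    have hε := mul_right_cancel₀ hn htr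
    rw [hε] at h
    -- The trace only tells whether the degree is zero; a nonzero degree is recovered below from the
    -- trace `n / r` of `(r⁻¹ A)²`.
    by_cases hr : r = 0
    · have hs : s = 0 := by
        by_contra hs
        simp [hr, hs] at hε
      subst hr hs
      simp [hG.adjMatrix_eq_zero, hH.adjMatrix_eq_zero]
    have hs : s ≠ 0 := by
      rintro rfl
      simp [hr] at hε
    have hr' : (r : ℝ) ≠ 0 := by exact_mod_cast hr
    have hs' : (s : ℝ) ≠ 0 := by exact_mod_cast hs
    have h1 : ((r : ℝ)⁻¹ • G.adjMatrix ℝ) * P = P * ((s : ℝ)⁻¹ • H.adjMatrix ℝ) := by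
      simpa [Matrix.sub_mul, Matrix.mul_sub, hs] using h
    have h2 := hP.trace_eq (show ((r : ℝ)⁻¹ • G.adjMatrix ℝ) * ((r : ℝ)⁻¹ • G.adjMatrix ℝ) * P =
        P * (((s : ℝ)⁻¹ • H.adjMatrix ℝ) * ((s : ℝ)⁻¹ • H.adjMatrix ℝ)) by
      rw [Matrix.mul_assoc, h1, ← Matrix.mul_assoc, h1, Matrix.mul_assoc])
    simp only [Matrix.smul_mul, Matrix.mul_smul, trace_smul, hG.trace_adjMatrix_mul_self,
      hH.trace_adjMatrix_mul_self, smul_eq_mul, hn'] at h2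
    have hrs : r = s := by
      field_simp at h2
      exact_mod_cast h2.symm
    subst hrs
    refine ⟨rfl, ?_⟩
    rw [Matrix.smul_mul, Matrix.mul_smul] at h1
    exact smul_right_injective _ (inv_ne_zero hr') h1

theorem CospectralReg.card_eq (h : CospectralReg G H) : Fintype.card V = Fintype.card W :=
  h.elim fun X hX =>
    (exists_isOrthogonal_of_roots_eq (isHermitian_matrixOf X G) (isHermitian_matrixOf X H) hX).1

theorem CospectralReg.exists_isOrthogonal [Nonempty V] (hG : G.IsRegularOfDegree r)
    (hH : H.IsRegularOfDegree s) (h : CospectralReg G H) :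
    r = s ∧ ∃ P : Matrix V W ℝ, P.IsOrthogonal ∧ G.adjMatrix ℝ * P = P * H.adjMatrix ℝ ∧
      P *ᵥ 1 = 1 := by
  have hcard := h.card_eq
  obtain ⟨X, hX⟩ := h
  obtain ⟨-, P, hP, hPX⟩ :=
    exists_isOrthogonal_of_roots_eq (isHermitian_matrixOf X G) (isHermitian_matrixOf X H) hX
  obtain ⟨rfl, hA⟩ := hG.eq_and_adjMatrix_mul_eq hH hcard hP hPX
  exact ⟨rfl, hP.exists_mulVec_one hcard G.transpose_adjMatrix hA hG.adjMatrix_mulVec_one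
    hH.adjMatrix_mulVec_one⟩

theorem IsRegularOfDegree.eq_top (h : G.IsRegularOfDegree r) (hr : r + 1 = Fintype.card V) :
    G = ⊤ := by
  ext u v
  rw [top_adj]
  refine ⟨Adj.ne, fun huv => ?_⟩
  have hs : G.neighborFinset u ⊆ Finset.univ.erase u := fun w hw => by
    rw [mem_neighborFinset] at hw
    simp [hw.ne']
  have := Finset.eq_of_subset_of_card_le hs (by
    rw [Finset.card_erase_of_mem (Finset.mem_univ _), Finset.card_univ, card_neighborFinset_eq_degree,
      h.degree_eq]
    omega)
  rw [← mem_neighborFinset, this]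
  simp [huv.symm]

/-- An orthogonal matrix intertwining the adjacency matrices and all functions of the degrees
shows cospectrality for all four matrices. -/
theorem xCospectral_of_intertwines (hcard : Fintype.card V = Fintype.card W) {P : Matrix V W ℝ}
    (hP : P.IsOrthogonal) (hA : G.adjMatrix ℝ * P = P * H.adjMatrix ℝ)
    (hD : ∀ f : ℕ → ℝ, diagonal (fun i => f (G.degree i)) * P =
      P * diagonal (fun i => f (H.degree i)))
    (X : MatrixKind) : XCospectral X G H := by
  have hdeg : G.degMatrix ℝ * P = P * H.degMatrix ℝ := hD fun n => n
  refine congrArg Polynomial.roots (hP.charpoly_eq hcard ?_)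
  cases X
  · exact hA
  · simp only [matrixOf, lapMatrix, Matrix.sub_mul, Matrix.mul_sub, hdeg, hA]
  · simp only [matrixOf, signlessLapMatrix, Matrix.add_mul, Matrix.mul_add, hdeg, hA]
  · have h1 := hD fun n => if n = 0 then 0 else 1
    have h2 := hD fun n => (√(n : ℝ))⁻¹
    simp only [matrixOf, normalizedLapMatrix_eq, Matrix.sub_mul, Matrix.mul_sub, h1]
    congr 1
    rw [Matrix.mul_assoc, h2, ← Matrix.mul_assoc, Matrix.mul_assoc _ _ P, hA, ← Matrix.mul_assoc,
      h2, Matrix.mul_assoc, Matrix.mul_assoc, Matrix.mul_assoc]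

end Regular

/-! ### Adjacency in the NNS join -/

section Adj

variable {V₁ V₂ : Type*} {G₁ : SimpleGraph V₁} {G₂ : SimpleGraph V₂}

@[simp]
theorem nnsJoin_adj_inl_inl (u w : V₁) : (nnsJoin G₁ G₂).Adj (.inl u) (.inl w) ↔ G₁.Adj u w :=
  Iff.rfl

@[simp]
theorem nnsJoin_adj_inl_inr_inl (u w : V₁) :
    (nnsJoin G₁ G₂).Adj (.inl u) (.inr (.inl w)) ↔ u ≠ w ∧ ¬ G₁.Adj u w :=
  Iff.rfl

@[simp]
theorem nnsJoin_adj_inl_inr_inr (u : V₁) (v : V₂) :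
    (nnsJoin G₁ G₂).Adj (.inl u) (.inr (.inr v)) ↔ True :=
  Iff.rfl

@[simp]
theorem nnsJoin_adj_inr_inl_inl (u w : V₁) :
    (nnsJoin G₁ G₂).Adj (.inr (.inl u)) (.inl w) ↔ u ≠ w ∧ ¬ G₁.Adj u w :=
  Iff.rfl

@[simp]
theorem nnsJoin_adj_inr_inl_inr (u : V₁) (x : V₁ ⊕ V₂) :
    (nnsJoin G₁ G₂).Adj (.inr (.inl u)) (.inr x) ↔ False := by
  cases x <;> exact Iff.rfl

@[simp]
theorem nnsJoin_adj_inr_inr_inl (v : V₂) (u : V₁) :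
    (nnsJoin G₁ G₂).Adj (.inr (.inr v)) (.inl u) ↔ True :=
  Iff.rfl

@[simp]
theorem nnsJoin_adj_inr_inr_inr_inl (v : V₂) (u : V₁) :
    (nnsJoin G₁ G₂).Adj (.inr (.inr v)) (.inr (.inl u)) ↔ False :=
  Iff.rfl

@[simp]
theorem nnsJoin_adj_inr_inr_inr_inr (v w : V₂) :
    (nnsJoin G₁ G₂).Adj (.inr (.inr v)) (.inr (.inr w)) ↔ G₂.Adj v w :=
  Iff.rfl

end Adj

/-! ### Degrees, block intertwiner and isomorphisms of NNS joins -/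

section NNSJoin

variable {V₁ V₂ W₁ W₂ : Type*} [Fintype V₁] [DecidableEq V₁] [Fintype V₂] [DecidableEq V₂]
  [Fintype W₁] [DecidableEq W₁] [Fintype W₂] [DecidableEq W₂]
  {G₁ : SimpleGraph V₁} [DecidableRel G₁.Adj] {G₂ : SimpleGraph V₂} [DecidableRel G₂.Adj]
  {H₁ : SimpleGraph W₁} [DecidableRel H₁.Adj] {H₂ : SimpleGraph W₂} [DecidableRel H₂.Adj]
  {r₁ r₂ : ℕ}

theorem degree_add_sum_nonadj_add_one (u : V₁) :
    G₁.degree u + (∑ w, if u ≠ w ∧ ¬ G₁.Adj u w then 1 else 0) + 1 = Fintype.card V₁ := by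
  have h1 : G₁.degree u = ∑ w, if G₁.Adj u w then 1 else 0 := by
    simpa using G₁.degree_eq_sum_if_adj (R := ℕ) u
  have h2 : (1 : ℕ) = ∑ w, if u = w then 1 else 0 := by simp
  rw [h1, show ∀ a b : ℕ, a + b + 1 = a + b + ∑ w, if u = w then 1 else 0 from
    fun a b => congrArg (a + b + ·) h2, ← Finset.sum_add_distrib, ← Finset.sum_add_distrib, ← Finset.card_univ,
    Finset.card_eq_sum_ones]
  refine Finset.sum_congr rfl fun w _ => ?_
  by_cases huw : u = w
  · subst huw; simp
  · by_cases h : G₁.Adj u w <;> simp [huw, h]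

theorem degree_nnsJoin_inl (u : V₁) :
    (nnsJoin G₁ G₂).degree (.inl u) + 1 = Fintype.card V₁ + Fintype.card V₂ := by
  have h := (nnsJoin G₁ G₂).degree_eq_sum_if_adj (R := ℕ) (.inl u)
  have h1 := G₁.degree_eq_sum_if_adj (R := ℕ) u
  have h2 := degree_add_sum_nonadj_add_one (G₁ := G₁) u
  simp only [Fintype.sum_sum_type, nnsJoin_adj_inl_inl, nnsJoin_adj_inl_inr_inl,
    nnsJoin_adj_inl_inr_inr,
    if_true, Nat.cast_id, Finset.sum_const,
    Finset.card_univ, smul_eq_mul, mul_one] at h h1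
  omega

theorem degree_nnsJoin_inr_inl (u : V₁) :
    (nnsJoin G₁ G₂).degree (.inr (.inl u)) + G₁.degree u + 1 = Fintype.card V₁ := by
  have h := (nnsJoin G₁ G₂).degree_eq_sum_if_adj (R := ℕ) (.inr (.inl u))
  have h2 := degree_add_sum_nonadj_add_one (G₁ := G₁) u
  simp only [Fintype.sum_sum_type, nnsJoin_adj_inr_inl_inl, nnsJoin_adj_inr_inl_inr,
    if_false, Nat.cast_id, Finset.sum_const_zero,
    add_zero] at h
  omega

theorem degree_nnsJoin_inr_inr (v : V₂) :
    (nnsJoin G₁ G₂).degree (.inr (.inr v)) = Fintype.card V₁ + G₂.degree v := by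
  have h := (nnsJoin G₁ G₂).degree_eq_sum_if_adj (R := ℕ) (.inr (.inr v))
  have h1 := G₂.degree_eq_sum_if_adj (R := ℕ) v
  simp only [Fintype.sum_sum_type, nnsJoin_adj_inr_inr_inl,
    nnsJoin_adj_inr_inr_inr_inl, nnsJoin_adj_inr_inr_inr_inr,
    if_true, if_false, Nat.cast_id, Finset.sum_const,
    Finset.card_univ, smul_eq_mul, mul_one, mul_zero, zero_add] at h h1
  omega

theorem not_isRegularGraph_nnsJoin [Nonempty V₁] [Nonempty V₂] :
    ¬ (nnsJoin G₁ G₂).IsRegularGraph := by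
  rintro ⟨d, hd⟩
  obtain ⟨u⟩ := ‹Nonempty V₁›
  have h1 := degree_nnsJoin_inl (G₁ := G₁) (G₂ := G₂) u
  have h2 := degree_nnsJoin_inr_inl (G₁ := G₁) (G₂ := G₂) u
  rw [hd.degree_eq] at h1 h2
  have := Fintype.card_pos (α := V₂)
  omega

/-- The block-diagonal matrix `diag(P₁, P₁, P₂)`. -/
def joinBlock (P₁ : Matrix V₁ W₁ ℝ) (P₂ : Matrix V₂ W₂ ℝ) :
    Matrix (V₁ ⊕ (V₁ ⊕ V₂)) (W₁ ⊕ (W₁ ⊕ W₂)) ℝ :=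
  fromBlocks P₁ 0 0 (fromBlocks P₁ 0 0 P₂)

theorem isOrthogonal_joinBlock {P₁ : Matrix V₁ W₁ ℝ} {P₂ : Matrix V₂ W₂ ℝ}
    (h₁ : P₁.IsOrthogonal) (h₂ : P₂.IsOrthogonal) : (joinBlock P₁ P₂).IsOrthogonal := by
  constructor <;>
  simp [joinBlock, fromBlocks_transpose, fromBlocks_multiply, h₁.mul_transpose_self,
    h₁.transpose_mul_self, h₂.mul_transpose_self, h₂.transpose_mul_self]

theorem of_nonadj_eq (G₁ : SimpleGraph V₁) [DecidableRel G₁.Adj] :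
    (Matrix.of fun u w => if u ≠ w ∧ ¬ G₁.Adj u w then (1 : ℝ) else 0) =
      vecMulVec 1 1 - 1 - G₁.adjMatrix ℝ := by
  ext u w
  by_cases huw : u = w
  · subst huw; simp
  · by_cases h : G₁.Adj u w <;> simp [huw, h]

/-- In `J - 1 - A`, the term `J` is intertwined because `P` and `Pᵀ` both fix the all-ones vector.
-/
theorem nonadj_mul_eq {P : Matrix V₁ W₁ ℝ} (hA : G₁.adjMatrix ℝ * P = P * H₁.adjMatrix ℝ)
    (h1 : P *ᵥ 1 = 1) (h2 : Pᵀ *ᵥ 1 = 1) :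
    (Matrix.of fun u w => if u ≠ w ∧ ¬ G₁.Adj u w then (1 : ℝ) else 0) * P =
      P * Matrix.of fun u w => if u ≠ w ∧ ¬ H₁.Adj u w then (1 : ℝ) else 0 := by
  rw [of_nonadj_eq, of_nonadj_eq, Matrix.sub_mul, Matrix.sub_mul, Matrix.mul_sub, Matrix.mul_sub, hA, vecMulVec_mul,
    mul_vecMulVec, h1, ← mulVec_transpose, h2, Matrix.one_mul, Matrix.mul_one]

theorem adjMatrix_nnsJoin_mul_joinBlock {P₁ : Matrix V₁ W₁ ℝ} {P₂ : Matrix V₂ W₂ ℝ}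
    (hA₁ : G₁.adjMatrix ℝ * P₁ = P₁ * H₁.adjMatrix ℝ)
    (hA₂ : G₂.adjMatrix ℝ * P₂ = P₂ * H₂.adjMatrix ℝ)
    (h1 : P₁ *ᵥ 1 = 1) (h1' : P₁ᵀ *ᵥ 1 = 1) (h2 : P₂ *ᵥ 1 = 1) (h2' : P₂ᵀ *ᵥ 1 = 1) :
    (nnsJoin G₁ G₂).adjMatrix ℝ * joinBlock P₁ P₂ =
      joinBlock P₁ P₂ * (nnsJoin H₁ H₂).adjMatrix ℝ := by
  have hN := nonadj_mul_eq hA₁ h1 h1'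
  have s1 : ∀ i, ∑ j, P₁ i j = 1 := fun i => by simpa [mulVec, dotProduct] using congrFun h1 i
  have s1' : ∀ j, ∑ i, P₁ i j = 1 := fun i => by simpa [mulVec, dotProduct] using congrFun h1' i
  have s2 : ∀ i, ∑ j, P₂ i j = 1 := fun i => by simpa [mulVec, dotProduct] using congrFun h2 i
  have s2' : ∀ j, ∑ i, P₂ i j = 1 := fun i => by simpa [mulVec, dotProduct] using congrFun h2' i
  have e1 : ∀ i j, _ := fun i j => congrFun (congrFun hA₁ i) j
  have e2 : ∀ i j, _ := fun i j => congrFun (congrFun hA₂ i) j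
  have e3 : ∀ i j, _ := fun i j => congrFun (congrFun hN i) j
  simp only [Matrix.mul_apply, adjMatrix_apply, of_apply] at e1 e2 e3
  ext i j
  rw [Matrix.mul_apply, Matrix.mul_apply]
  rcases i with i | i | i <;> rcases j with j | j | j <;>
    simp [joinBlock, Fintype.sum_sum_type, adjMatrix_apply, s1, s2, s1', s2'] <;>
    first
    | simpa using e1 i j
    | simpa using e2 i j
    | simpa using e3 i j

theorem diagonal_mul_joinBlock {P₁ : Matrix V₁ W₁ ℝ} {P₂ : Matrix V₂ W₂ ℝ}
    (hG₁ : G₁.IsRegularOfDegree r₁) (hH₁ : H₁.IsRegularOfDegree r₁)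
    (hG₂ : G₂.IsRegularOfDegree r₂) (hH₂ : H₂.IsRegularOfDegree r₂)
    (hc₁ : Fintype.card V₁ = Fintype.card W₁) (hc₂ : Fintype.card V₂ = Fintype.card W₂)
    (f : ℕ → ℝ) :
    diagonal (fun i => f ((nnsJoin G₁ G₂).degree i)) * joinBlock P₁ P₂ =
      joinBlock P₁ P₂ * diagonal (fun i => f ((nnsJoin H₁ H₂).degree i)) := by
  ext i j
  rw [diagonal_mul, mul_diagonal]
  rcases i with i | i | i <;> rcases j with j | j | j
  · have h1 := degree_nnsJoin_inl (G₁ := G₁) (G₂ := G₂) i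
    have h2 := degree_nnsJoin_inl (G₁ := H₁) (G₂ := H₂) j
    rw [mul_comm, show (nnsJoin G₁ G₂).degree (.inl i) = (nnsJoin H₁ H₂).degree (.inl j) by omega]
  · simp [joinBlock]
  · simp [joinBlock]
  · simp [joinBlock]
  · have h1 := degree_nnsJoin_inr_inl (G₁ := G₁) (G₂ := G₂) i
    have h2 := degree_nnsJoin_inr_inl (G₁ := H₁) (G₂ := H₂) j
    rw [hG₁.degree_eq] at h1
    rw [hH₁.degree_eq] at h2
    rw [mul_comm, show (nnsJoin G₁ G₂).degree (.inr (.inl i)) =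
      (nnsJoin H₁ H₂).degree (.inr (.inl j)) by omega]
  · simp [joinBlock]
  · simp [joinBlock]
  · simp [joinBlock]
  · rw [mul_comm, degree_nnsJoin_inr_inr, degree_nnsJoin_inr_inr, hG₂.degree_eq, hH₂.degree_eq,
      hc₁]

/-- An isomorphism of NNS joins of regular graphs with the same parameters yields an isomorphism
of the second factors. -/
theorem nonempty_iso_of_nnsJoin_iso
    (hG₂ : G₂.IsRegularOfDegree r₂) (hH₂ : H₂.IsRegularOfDegree r₂)
    (hc₁ : Fintype.card V₁ = Fintype.card W₁) (hc₂ : Fintype.card V₂ = Fintype.card W₂)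
    (φ : nnsJoin G₁ G₂ ≃g nnsJoin H₁ H₂) : Nonempty (G₂ ≃g H₂) := by
  -- Vertices of the second factor have degree `n₁ + r₂`, those of the first `n₁ + n₂ - 1`, and the
  -- copies less than `n₁`. The first two agree only for complete second factors, which are
  -- isomorphic anyway.
  by_cases hr : r₂ + 1 = Fintype.card V₂
  · obtain rfl := hG₂.eq_top hr
    obtain rfl := hH₂.eq_top (hr.trans hc₂)
    exact ⟨Iso.completeGraph (Fintype.equivOfCardEq hc₂)⟩
  have hex : ∀ v : V₂, ∃ w : W₂, φ (.inr (.inr v)) = .inr (.inr w) := by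
    intro v
    have hd := φ.degree_eq (.inr (.inr v))
    rw [degree_nnsJoin_inr_inr, hG₂.degree_eq] at hd
    rcases hφ : φ (.inr (.inr v)) with w | w | w
    · rw [hφ] at hd
      have := degree_nnsJoin_inl (G₁ := H₁) (G₂ := H₂) w
      omega
    · rw [hφ] at hd
      have := degree_nnsJoin_inr_inl (G₁ := H₁) (G₂ := H₂) w
      omega
    · exact ⟨w, rfl⟩
  choose g hg using hex
  have hinj : Function.Injective g := fun a b hab => by
    have : φ (.inr (.inr a)) = φ (.inr (.inr b)) := by rw [hg, hg, hab]
    simpa using this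
  refine ⟨⟨Equiv.ofBijective g ((Fintype.bijective_iff_injective_and_card g).2 ⟨hinj, hc₂⟩), ?_⟩⟩
  intro a b
  have := φ.map_adj_iff (v := .inr (.inr a)) (w := .inr (.inr b))
  rw [hg, hg] at this
  exact this

end NNSJoin

end SimpleGraph

/-! ### The main theorem -/

theorem mainTheorem12 {V₁ V₂ W₁ W₂ : Type*}
    [Fintype V₁] [DecidableEq V₁] [Fintype V₂] [DecidableEq V₂]
    [Fintype W₁] [DecidableEq W₁] [Fintype W₂] [DecidableEq W₂]
    [Nonempty V₁]
    (G₁ : SimpleGraph V₁) [DecidableRel G₁.Adj] (G₂ : SimpleGraph V₂) [DecidableRel G₂.Adj]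
    (H₁ : SimpleGraph W₁) [DecidableRel H₁.Adj] (H₂ : SimpleGraph W₂) [DecidableRel H₂.Adj]
    (hG₁ : G₁.IsRegularGraph) (hH₁ : H₁.IsRegularGraph)
    (hcosp₁ : SimpleGraph.CospectralReg G₁ H₁)
    (hG₂ : G₂.IsRegularGraph) (hH₂ : H₂.IsRegularGraph)
    (hcosp₂ : SimpleGraph.CospectralReg G₂ H₂)
    (hniso : IsEmpty (G₂ ≃g H₂)) :
    ¬ (SimpleGraph.nnsJoin G₁ G₂).IsRegularGraph ∧
    ¬ (SimpleGraph.nnsJoin H₁ H₂).IsRegularGraph ∧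
    SimpleGraph.ALQNNICS (SimpleGraph.nnsJoin G₁ G₂) (SimpleGraph.nnsJoin H₁ H₂) := by
  obtain ⟨r₁, hG₁⟩ := hG₁
  obtain ⟨s₁, hH₁⟩ := hH₁
  obtain ⟨r₂, hG₂⟩ := hG₂
  obtain ⟨s₂, hH₂⟩ := hH₂
  have hc₁ := hcosp₁.card_eq
  have hc₂ := hcosp₂.card_eq
  -- Empty second factors would be isomorphic.
  have hV₂ : Nonempty V₂ := by
    by_contra h
    rw [not_nonempty_iff] at h
    exact hniso.false ⟨Fintype.equivOfCardEq hc₂, fun {a} => h.elim a⟩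
  have hW₁ : Nonempty W₁ := by rw [← Fintype.card_pos_iff, ← hc₁]; exact Fintype.card_pos
  have hW₂ : Nonempty W₂ := by rw [← Fintype.card_pos_iff, ← hc₂]; exact Fintype.card_pos
  obtain ⟨rfl, P₁, hP₁, hA₁, h1⟩ := hcosp₁.exists_isOrthogonal hG₁ hH₁
  obtain ⟨rfl, P₂, hP₂, hA₂, h2⟩ := hcosp₂.exists_isOrthogonal hG₂ hH₂
  refine ⟨SimpleGraph.not_isRegularGraph_nnsJoin, SimpleGraph.not_isRegularGraph_nnsJoin,
    fun X => ⟨?_, ⟨fun φ => ?_⟩⟩⟩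
  · exact SimpleGraph.xCospectral_of_intertwines (by simp [hc₁, hc₂])
      (SimpleGraph.isOrthogonal_joinBlock hP₁ hP₂)
      (SimpleGraph.adjMatrix_nnsJoin_mul_joinBlock hA₁ hA₂ h1 (hP₁.transpose_mulVec_one h1) h2
        (hP₂.transpose_mulVec_one h2))
      (SimpleGraph.diagonal_mul_joinBlock hG₁ hH₁ hG₂ hH₂ hc₁ hc₂) X
  · obtain ⟨ψ⟩ := SimpleGraph.nonempty_iso_of_nnsJoin_iso hG₂ hH₂ hc₁ hc₂ φ
    exact hniso.false ψ
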